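/- **Setting.** Let $n,\ell\in\mathbb N_0$ and $0=\tau_0<\tau_1<\dots<\tau_\ell=r$. Let $|\cdot|$ be the max norm on $\mathbb R^n$ and on $\mathbb R^{(\ell+1)n}$, let $\mathcal L^\infty$ be the set of essentially bounded Lebesgue measurable functions $[-r,0]\to\mathbb R^n$, and let $L^\infty$ be the space of their classes modulo equality almost everywhere, with the essential supremum norm $\|\cdot\|$. A sequence $\phi^k\in L^\infty$ converges weakly-* to $\phi^0\in L^\infty$, written $\phi^k\rightharpoonup\phi^0$, if $\int_{-r}^0 g^T\phi^k\,ds\to\int_{-r}^0 g^T\phi^0\,ds$ for all $g\in L^1([-r,0],\mathbb R^n)$. For a history $\phi$ and a function $x$ on an interval starting at $t_0$, the concatenation $\mathsf x=\phi\diamond_{t_0}x$ is given by $\mathsf x(t)=\phi(t-t_0)$ for $t_0-r\le t<t_0$ and $\mathsf x(t)=x(t)$ for $t\ge t_0$. Put $\mathsf x_t(s)=\mathsf x(t+s)$ for $s\in[-r,0]$ and $\mathsf x(t-\tau_{0:\ell})=(\mathsf x(t-\tau_0),\dots,\mathsf x(t-\tau_\ell))$. **Assumptions.** Let $f:\mathbb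 R_{\ge0}\times\mathbb R^{(\ell+1)n}\times L^\infty\to\mathbb R^n$ satisfy the following. 1. For all $R,T>0$ there are $L\ge0$ and a null set $Z$ such that $|f(t,\xi,\phi)-f(t,\zeta,\psi)|\le L\max\{|\xi-\zeta|,\|\phi-\psi\|\}$ whenever $t\in[0,T]\setminus Z$ and $|\xi|,|\zeta|,\|\phi\|,\|\psi\|\le R$. 2. $f(\cdot,0,0)$ is locally essentially bounded. 3. For all $0\le t_0<T$, $\phi\in\mathcal L^\infty$ and continuous $x:[t_0,T]\to\mathbb R^n$, the function $t\mapsto f(t,\mathsf x(t-\tau_{0:\ell}),\mathsf x_t)$, $\mathsf x=\phi\diamond_{t_0}x$, is Lebesgue measurable on $[t_0,T]$. 4. For all $T,R>0$ there is a null set $Z$ such that for every $\varepsilon>0$ and every sequence $\phi^k\rightharpoonup\phi^0$ with $\|\phi^k\|\le R$ there is $j$ with $|f(t,\xi,\phi^k)-f(t,\xi,\phi^0)|<\varepsilon$ for all $t\in[0,T]\setminus Z$, $|\xi|\le R$ and $k\ge j$. 5. For all $t_0\ge0$, $R\ge0$, continuous $x:[t_0,t_0+r]\to\mathbb R^n$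 with $|x|\le R$, sequences $\phi^k\rightharpoonup\phi^0$ with $\|\phi^k\|\le R$, and $\varepsilon>0$, there is $j$ such that for all $t\in[t_0,t_0+r]$ and $k\ge j$, with $\mathsf x^k=\phi^k\diamond_{t_0}x$ and $\mathsf x^0=\phi^0\diamond_{t_0}x$, the integral below is well defined and $$\Big|\int_{t_0}^t\big[f(s,\mathsf x^k(s-\tau_{0:\ell}),\mathsf x^0_s)-f(s,\mathsf x^0(s-\tau_{0:\ell}),\mathsf x^0_s)\big]ds\Big|<\varepsilon .$$ **System.** Consider, for $t_0\ge0$ and $(\xi,\phi)\in\mathbb R^n\times L^\infty$, $$\dot x(t)=f(t,\mathsf x(t-\tau_{0:\ell}),\mathsf x_t)\quad(t\ge t_0),\qquad \mathsf x=\phi\diamond_{t_0}x,\qquad x(t_0)=\xi .$$ A solution on an interval $J=[t_0,b)$ or $[t_0,b]$, $t_0<b\le\infty$, is a locally absolutely continuous $x:J\to\mathbb R^n$ with $x(t)=\xi+\int_{t_0}^tf(s,\mathsf x(s-\tau_{0:\ell}),\mathsf x_s)\,ds$ for all $t\in J$ (the representative of $\phi$ is immaterial); it is maximally defined if it has no strict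 extension to a solution. The system is *forward complete* if for all $t_0\ge0$ and $(\xi,\phi)\in\mathbb R^n\times L^\infty$ there is a maximally defined solution with domain $[t_0,\infty)$. It has *bounded reachability sets* if it is forward complete and for all $0\le t_0<T$ and $R>0$ there is $M$ such that every maximally defined solution $x$ from initial time $t_0$ and any $(\xi,\phi)$ with $|\xi|\le R$, $\|\phi\|\le R$ is defined and satisfies $|x(t)|\le M$ for all $t\in[t_0,T]$. **Corollary 1.** Under these assumptions, the system is forward complete if and only if it has bounded reachability sets. -/

import Mathlib

open MeasureTheory Set Filter Topology
open scoped ENNReal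

namespace DelaySystem

/-- Lebesgue measure on the history interval `[-r, 0]`. -/
noncomputable abbrev histMeasure (r : ℝ) : Measure ℝ := volume.restrict (Icc (-r) 0)

/-- `L^∞([-r,0], ℝⁿ)`: classes modulo equality a.e., with the essential supremum norm. As everywhere
below, `ℝⁿ = Fin n → ℝ` carries the max norm. -/
abbrev LInf (n : ℕ) (r : ℝ) : Type := Lp (Fin n → ℝ) ∞ (histMeasure r)

/-- Right-hand sides `f (t, (ξ₀, …, ξ_ℓ), φ)`. Only the values at times `t ≥ 0` are ever used. -/
abbrev RHS (n ℓ : ℕ) (r : ℝ) : Type :=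
  ℝ → (Fin (ℓ + 1) → Fin n → ℝ) → LInf n r → (Fin n → ℝ)

/-- The concatenation of the history `φ` (shifted to `[t₀ - r, t₀)`) and of `x` (from `t₀` on). -/
noncomputable def conc {n : ℕ} (t₀ : ℝ) (φ x : ℝ → Fin n → ℝ) : ℝ → Fin n → ℝ :=
  fun t => if t < t₀ then φ (t - t₀) else x t

open Classical in
/-- The class in `L^∞([-r,0], ℝⁿ)` of the segment `s ↦ X (t + s)`. The segment is essentially bounded
wherever this is used, see `memLp_conc_segment`; the value `0` in the other case plays no role. -/
noncomputable def segment {n : ℕ} (r : ℝ) (X : ℝ → Fin n → ℝ) (t : ℝ) : LInf n r :=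
  if h : MemLp (fun s => X (t + s)) ∞ (histMeasure r) then h.toLp _ else 0

/-- The discrete-delay argument `(X (t - τ₀), …, X (t - τ_ℓ))`. -/
def delayed {n ℓ : ℕ} (τ : Fin (ℓ + 1) → ℝ) (X : ℝ → Fin n → ℝ) (t : ℝ) :
    Fin (ℓ + 1) → Fin n → ℝ :=
  fun i => X (t - τ i)

theorem memLp_conc_segment {n : ℕ} {r t₀ T t : ℝ} {φ x : ℝ → Fin n → ℝ}
    (hφ : MemLp φ ∞ (histMeasure r)) (hx : ContinuousOn x (Icc t₀ T)) (ht : t ∈ Icc t₀ T) :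
    MemLp (fun s => conc t₀ φ x (t + s)) ∞ (histMeasure r) := by
  have hA : MeasurableSet {s : ℝ | t + s < t₀} := measurableSet_lt (by fun_prop) (by fun_prop)
  have h1 : MemLp (fun s => φ (t + s - t₀)) ∞
      ((histMeasure r).restrict {s : ℝ | t + s < t₀}) := by
    have hmp : MeasurePreserving (fun s : ℝ => s + (t - t₀)) volume volume :=
      measurePreserving_add_right volume (t - t₀)
    have h := hφ.comp_measurePreserving
      (hmp.restrict_preimage (measurableSet_Icc (a := -r) (b := (0 : ℝ))))
    have h' : MemLp (fun s => φ (t + s - t₀)) ∞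
        (volume.restrict ((fun s : ℝ => s + (t - t₀)) ⁻¹' Icc (-r) 0)) := by
      convert h using 1
      funext s
      simp only [Function.comp_apply]
      congr 1
      ring
    refine h'.mono_measure ?_
    rw [histMeasure, Measure.restrict_restrict hA]
    refine Measure.restrict_mono ?_ le_rfl
    rintro s ⟨hs, hs'⟩
    simp only [mem_ofPred_eq, mem_Icc, mem_preimage] at *
    constructor <;> linarith [ht.1]
  have h2 : MemLp (fun s => x (t + s)) ∞
      ((histMeasure r).restrict {s : ℝ | t + s < t₀}ᶜ) := by
    have hc : ContinuousOn (fun s => x (t + s)) (Icc (t₀ - t) 0) := by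
      refine hx.comp (by fun_prop) ?_
      intro s hs
      exact ⟨by linarith [hs.1], by linarith [hs.2, ht.2]⟩
    have h : MemLp (fun s => x (t + s)) ∞ (volume.restrict (Icc (t₀ - t) 0)) := by
      obtain ⟨C, hC⟩ := isCompact_Icc.exists_bound_of_continuousOn hc
      exact memLp_top_of_bound (hc.aestronglyMeasurable measurableSet_Icc) C
        (ae_restrict_of_forall_mem measurableSet_Icc hC)
    refine h.mono_measure ?_
    rw [histMeasure, Measure.restrict_restrict hA.compl]
    refine Measure.restrict_mono ?_ le_rfl
    rintro s ⟨hs, hs'⟩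
    simp only [mem_ofPred_eq, mem_Icc, mem_compl_iff, not_lt] at *
    constructor <;> linarith
  classical
  have h := MemLp.piecewise hA h1 h2
  exact h

/-- Weak-* convergence in `L^∞([-r,0], ℝⁿ)`, tested against all `g ∈ L^1([-r,0], ℝⁿ)`. -/
def WeakStarTendsto {n : ℕ} {r : ℝ} (φ : ℕ → LInf n r) (φ₀ : LInf n r) : Prop :=
  ∀ g : ℝ → Fin n → ℝ, Integrable g (histMeasure r) →
    Tendsto (fun k => ∫ s, g s ⬝ᵥ φ k s ∂(histMeasure r)) atTop
      (𝓝 (∫ s, g s ⬝ᵥ φ₀ s ∂(histMeasure r)))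

/-- The basic regularity assumption, uniformly over a family `F` of right-hand sides: the Lipschitz
constant and the local essential bound do not depend on `f ∈ F`, the null sets may. -/
structure UniformLipschitz {n ℓ : ℕ} {r : ℝ} (τ : Fin (ℓ + 1) → ℝ) (F : Set (RHS n ℓ r)) :
    Prop where
  lipschitz : ∀ R > 0, ∀ T > 0, ∃ L : ℝ, 0 ≤ L ∧ ∀ f ∈ F, ∃ Z : Set ℝ, volume Z = 0 ∧
    ∀ t ∈ Icc 0 T \ Z, ∀ ξ ζ : Fin (ℓ + 1) → Fin n → ℝ, ∀ φ ψ : LInf n r,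
      ‖ξ‖ ≤ R → ‖ζ‖ ≤ R → ‖φ‖ ≤ R → ‖ψ‖ ≤ R →
        ‖f t ξ φ - f t ζ ψ‖ ≤ L * max ‖ξ - ζ‖ ‖φ - ψ‖
  bounded_zero : ∀ T > 0, ∃ M : ℝ, ∀ f ∈ F, ∀ᵐ t ∂(volume.restrict (Icc 0 T)), ‖f t 0 0‖ ≤ M
  measurable : ∀ f ∈ F, ∀ t₀ ≥ 0, ∀ T > t₀, ∀ φ x : ℝ → Fin n → ℝ,
    MemLp φ ∞ (histMeasure r) → ContinuousOn x (Icc t₀ T) →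
      AEMeasurable (fun t => f t (delayed τ (conc t₀ φ x) t) (segment r (conc t₀ φ x) t))
        (volume.restrict (Icc t₀ T))

/-- The weak-* continuity assumption on a family `F` of right-hand sides. The class `φ k ∈ L^∞` enters
`conc` through a representative; another one changes the integrand on a null set of times only. -/
structure WeakStarAssumption {n ℓ : ℕ} {r : ℝ} (τ : Fin (ℓ + 1) → ℝ) (F : Set (RHS n ℓ r)) :
    Prop extends UniformLipschitz τ F where
  distributed : ∀ T > 0, ∀ R > 0, ∃ Z : RHS n ℓ r → Set ℝ, (∀ f ∈ F, volume (Z f) = 0) ∧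
    ∀ ε > 0, ∀ (φ : ℕ → LInf n r) (φ₀ : LInf n r), (∀ k, ‖φ k‖ ≤ R) → WeakStarTendsto φ φ₀ →
      ∃ j : ℕ, ∀ f ∈ F, ∀ t ∈ Icc 0 T \ Z f, ∀ ξ : Fin (ℓ + 1) → Fin n → ℝ, ‖ξ‖ ≤ R →
        ∀ k ≥ j, ‖f t ξ (φ k) - f t ξ φ₀‖ < ε
  discrete : ∀ t₀ ≥ 0, ∀ R ≥ 0, ∀ x : ℝ → Fin n → ℝ,
    ContinuousOn x (Icc t₀ (t₀ + r)) → (∀ t ∈ Icc t₀ (t₀ + r), ‖x t‖ ≤ R) →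
    ∀ (φ : ℕ → LInf n r) (φ₀ : LInf n r), (∀ k, ‖φ k‖ ≤ R) → WeakStarTendsto φ φ₀ →
    ∀ ε > 0, ∃ j : ℕ, ∀ t ∈ Icc t₀ (t₀ + r), ∀ k ≥ j, ∀ f ∈ F,
      IntervalIntegrable (fun s =>
        f s (delayed τ (conc t₀ (φ k) x) s) (segment r (conc t₀ φ₀ x) s)
          - f s (delayed τ (conc t₀ φ₀ x) s) (segment r (conc t₀ φ₀ x) s)) volume t₀ t ∧
      ‖∫ s in t₀..t,
        (f s (delayed τ (conc t₀ (φ k) x) s) (segment r (conc t₀ φ₀ x) s)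
          - f s (delayed τ (conc t₀ φ₀ x) s) (segment r (conc t₀ φ₀ x) s))‖ < ε

/-- `J = [t₀, b)` or `J = [t₀, b]` with `t₀ < b ≤ ∞`. -/
def IsForwardInterval (t₀ : ℝ) (J : Set ℝ) : Prop :=
  J = Ici t₀ ∨ ∃ b > t₀, J = Ico t₀ b ∨ J = Icc t₀ b

/-- `x` is, on `J`, a solution of `x'(t) = f (t, X (t - τ₀), …, X (t - τ_ℓ), X_t)` with initial time
`t₀`, `x (t₀) = ξ` and history `φ`, where `X` is the concatenation of `φ` and `x`. The values of `x`
outside `J` play no role, and neither does the choice of the representative of `φ`. -/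
structure IsSolution {n ℓ : ℕ} {r : ℝ} (τ : Fin (ℓ + 1) → ℝ) (f : RHS n ℓ r) (t₀ : ℝ)
    (ξ : Fin n → ℝ) (φ : LInf n r) (J : Set ℝ) (x : ℝ → Fin n → ℝ) : Prop where
  interval : IsForwardInterval t₀ J
  absCont : ∀ t ∈ J, AbsolutelyContinuousOnInterval x t₀ t
  integrable : ∀ t ∈ J, IntervalIntegrable
    (fun s => f s (delayed τ (conc t₀ φ x) s) (segment r (conc t₀ φ x) s)) volume t₀ t
  eq_integral : ∀ t ∈ J, x t = ξ + ∫ s in t₀..t,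
    f s (delayed τ (conc t₀ φ x) s) (segment r (conc t₀ φ x) s)

/-- A solution without strict extension. -/
def IsMaximalSolution {n ℓ : ℕ} {r : ℝ} (τ : Fin (ℓ + 1) → ℝ) (f : RHS n ℓ r) (t₀ : ℝ)
    (ξ : Fin n → ℝ) (φ : LInf n r) (J : Set ℝ) (x : ℝ → Fin n → ℝ) : Prop :=
  IsSolution τ f t₀ ξ φ J x ∧
    ∀ (J' : Set ℝ) (y : ℝ → Fin n → ℝ), IsSolution τ f t₀ ξ φ J' y → J ⊆ J' → EqOn x y J → J' = J

/-- Forward completeness: from every initial time and initial condition `(ξ, φ) ∈ ℝⁿ × L^∞` there is a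
maximally defined solution whose domain is `[t₀, ∞)`. -/
def ForwardComplete {n ℓ : ℕ} {r : ℝ} (τ : Fin (ℓ + 1) → ℝ) (f : RHS n ℓ r) : Prop :=
  ∀ t₀ ≥ 0, ∀ (ξ : Fin n → ℝ) (φ : LInf n r),
    ∃ x : ℝ → Fin n → ℝ, IsMaximalSolution τ f t₀ ξ φ (Ici t₀) x

/-- Bounded reachability sets: forward completeness, and a common bound on `[t₀, T]` for the maximally
defined solutions from all initial conditions with `|ξ| ≤ R` and `‖φ‖ ≤ R`. -/
def BoundedReachabilitySets {n ℓ : ℕ} {r : ℝ} (τ : Fin (ℓ + 1) → ℝ) (f : RHS n ℓ r) : Prop :=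
  ForwardComplete τ f ∧
    ∀ t₀ ≥ 0, ∀ T > t₀, ∀ R > 0, ∃ M : ℝ, ∀ (ξ : Fin n → ℝ) (φ : LInf n r), ‖ξ‖ ≤ R → ‖φ‖ ≤ R →
      ∀ (J : Set ℝ) (x : ℝ → Fin n → ℝ), IsMaximalSolution τ f t₀ ξ φ J x →
        ∀ t ∈ Icc t₀ T, t ∈ J ∧ ‖x t‖ ≤ M

end DelaySystem

/-!
Closed balls of `L^∞` are weakly-* sequentially compact, and solutions depend continuously on the
initial data, uniformly on compact time intervals, when the histories carry the weak-* topology. If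
solutions starting in a bounded set took arbitrarily large values on `[t₀, T]`, the initial data
would converge along a subsequence, and the solutions would then converge uniformly to the global
solution with the limiting initial data, which is bounded on `[t₀, T]`.

For the continuous dependence, compare a solution `x` with the limit solution `x₀`. The right-hand
side along the *fixed* `x₀` has integrals that converge uniformly when the histories converge
weakly-*: on `[t₀, t₀ + r]` this is the assumption on the discrete delays plus dominated convergence
for the distributed one, and afterwards the histories are no longer seen. What remains is a
Lipschitz term in `x - x₀`, absorbed by Gronwall's inequality as long as `x` stays near `x₀`.
-/

namespace DelaySystem

theorem exists_subseq_tendsto_strongDual {𝕜 E : Type*} [NontriviallyNormedField 𝕜] [ProperSpace 𝕜]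
    [SeminormedAddCommGroup E] [NormedSpace 𝕜 E] [TopologicalSpace.SeparableSpace E] {C : ℝ}
    {Λ : ℕ → StrongDual 𝕜 E} (hΛ : ∀ k, ‖Λ k‖ ≤ C) :
    ∃ (Λ₀ : StrongDual 𝕜 E) (σ : ℕ → ℕ), StrictMono σ ∧
      ∀ g, Tendsto (fun k => Λ (σ k) g) atTop (𝓝 (Λ₀ g)) := by
  obtain ⟨Λ₀, -, σ, hσ, hlim⟩ := WeakDual.isSeqCompact_closedBall 𝕜 E 0 C
    (x := fun k => StrongDual.toWeakDual (Λ k)) fun k => by simpa using hΛ k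
  exact ⟨WeakDual.toStrongDual Λ₀, σ, hσ, fun g =>
    (WeakDual.eval_continuous g).continuousAt.tendsto.comp hlim⟩

section Dual

variable {α : Type*} [MeasurableSpace α] {μ : Measure α} [IsFiniteMeasure μ]

theorem ae_abs_le_of_forall_abs_setIntegral_le {w : α → ℝ} {C : ℝ} (hw : Integrable w μ)
    (h : ∀ A, MeasurableSet A → |∫ x in A, w x ∂μ| ≤ C * μ.real A) : ∀ᵐ x ∂μ, |w x| ≤ C := by
  have hle : w ≤ᵐ[μ] fun _ => C := ae_le_of_forall_setIntegral_le hw (integrable_const C)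
    fun A hA _ => by simpa [mul_comm] using (abs_le.1 (h A hA)).2
  have hge : (fun _ => -C) ≤ᵐ[μ] w := ae_le_of_forall_setIntegral_le (integrable_const _) hw
    fun A hA _ => by simpa [mul_comm] using (abs_le.1 (h A hA)).1
  filter_upwards [hle, hge] with x hx hx' using abs_le.2 ⟨hx', hx⟩

theorem exists_setIntegral_eq_strongDual_indicatorConstLp (Λ : StrongDual ℝ (Lp ℝ 1 μ)) :
    ∃ w : Lp ℝ 2 μ, ∀ (A : Set α) (hA : MeasurableSet A),
      Λ (indicatorConstLp 1 hA (measure_ne_top μ A) 1) = ∫ x in A, w x ∂μ := by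
  -- The inclusion `L² ⊆ L¹` of a finite measure space, as multiplication by `1 ∈ L²`.
  let incl : Lp ℝ 2 μ →L[ℝ] Lp ℝ 1 μ :=
    (ContinuousLinearMap.mul ℝ ℝ).holderL μ 2 2 1 (indicatorConstLp 2 .univ (measure_ne_top μ _) 1)
  have hincl (A : Set α) (hA : MeasurableSet A) :
      incl (indicatorConstLp 2 hA (measure_ne_top μ A) 1) =
        indicatorConstLp 1 hA (measure_ne_top μ A) 1 := by
    refine Lp.ext ?_
    filter_upwards [(ContinuousLinearMap.mul ℝ ℝ).coeFn_holder (r := 1)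
      (indicatorConstLp 2 .univ (measure_ne_top μ _) 1)
      (indicatorConstLp 2 hA (measure_ne_top μ A) 1),
      indicatorConstLp_coeFn (p := 2) (hs := .univ) (hμs := measure_ne_top μ _) (c := (1 : ℝ)),
      indicatorConstLp_coeFn (p := 2) (hs := hA) (hμs := measure_ne_top μ _) (c := (1 : ℝ)),
      indicatorConstLp_coeFn (p := 1) (hs := hA) (hμs := measure_ne_top μ _) (c := (1 : ℝ))]
      with x hmul hone hA₂ hA₁
    refine hmul.trans ?_
    rw [ContinuousLinearMap.mul_apply', hone, hA₂, hA₁, indicator_univ, one_mul]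
  refine ⟨(InnerProductSpace.toDual ℝ _).symm (Λ ∘L incl), fun A hA => ?_⟩
  rw [← L2.inner_indicatorConstLp_one hA (measure_ne_top μ A), real_inner_comm,
    InnerProductSpace.toDual_symm_apply, ContinuousLinearMap.comp_apply, hincl]

theorem exists_strongDual_L1_eq_integral_mul (Λ : StrongDual ℝ (Lp ℝ 1 μ)) :
    ∃ ψ : Lp ℝ ∞ μ, ∀ g : Lp ℝ 1 μ, Λ g = ∫ x, g x * ψ x ∂μ := by
  obtain ⟨w, hw⟩ := exists_setIntegral_eq_strongDual_indicatorConstLp Λ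
  have hbound : ∀ᵐ x ∂μ, |w x| ≤ ‖Λ‖ := by
    refine ae_abs_le_of_forall_abs_setIntegral_le ((Lp.memLp w).integrable one_le_two)
      fun A hA => ?_
    rw [← hw A hA, ← Real.norm_eq_abs]
    refine (Λ.le_opNorm _).trans_eq ?_
    simp [norm_indicatorConstLp one_ne_zero ENNReal.one_ne_top]
  let ψ : Lp ℝ ∞ μ := (memLp_top_of_bound (Lp.memLp w).1 ‖Λ‖ hbound).toLp w
  have hψ : ψ =ᵐ[μ] w := MemLp.coeFn_toLp _
  let pair : StrongDual ℝ (Lp ℝ 1 μ) := ((ContinuousLinearMap.mul ℝ ℝ).lpPairing μ 1 ∞).flip ψ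
  have hpair (g : Lp ℝ 1 μ) : pair g = ∫ x, g x * ψ x ∂μ :=
    (ContinuousLinearMap.mul ℝ ℝ).lpPairing_eq_integral g ψ
  refine ⟨ψ, fun g => (?_ : Λ g = pair g).trans (hpair g)⟩
  induction g using Lp.induction ENNReal.one_ne_top with
  | @indicatorConst c A hA hμA =>
    have hsmul : indicatorConstLp 1 hA hμA.ne c =
        c • indicatorConstLp 1 hA (measure_ne_top μ A) 1 := by
      rw [indicatorConstLp, indicatorConstLp, ← MemLp.toLp_const_smul]
      congr 1
      ext x
      simp [indicator]
    have hone : pair (indicatorConstLp 1 hA (measure_ne_top μ A) 1) = ∫ x in A, w x ∂μ := by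
      rw [hpair, ← integral_indicator hA]
      refine integral_congr_ae ?_
      filter_upwards [hψ, indicatorConstLp_coeFn (p := 1) (hs := hA)
        (hμs := measure_ne_top μ A) (c := (1 : ℝ))] with x hx hx'
      rw [hx, hx', ← indicator_mul_left]
      simp
    rw [Lp.simpleFunc.coe_indicatorConst, hsmul, map_smul, map_smul, hw A hA, hone]
  | add hf hg _ hΛf hΛg => rw [map_add, map_add, hΛf, hΛg]
  | isClosed => exact isClosed_eq Λ.continuous pair.continuous

theorem exists_strongDual_L1_eq_integral_dotProduct {ι : Type*} [Fintype ι]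
    (Λ : StrongDual ℝ (Lp (ι → ℝ) 1 μ)) :
    ∃ ψ : Lp (ι → ℝ) ∞ μ, ∀ g : Lp (ι → ℝ) 1 μ, Λ g = ∫ x, g x ⬝ᵥ ψ x ∂μ := by
  classical
  let single (i : ι) : ℝ →L[ℝ] ι → ℝ := ContinuousLinearMap.single ℝ (fun _ => ℝ) i
  let proj (i : ι) : (ι → ℝ) →L[ℝ] ℝ := ContinuousLinearMap.proj i
  choose ψ hψ using fun i => exists_strongDual_L1_eq_integral_mul (Λ ∘L (single i).compLpL 1 μ)
  have hmem : MemLp (fun x i => ψ i x) ∞ μ := MemLp.of_eval fun i => Lp.memLp (ψ i)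
  refine ⟨hmem.toLp _, fun g => ?_⟩
  have hsum : g = ∑ i, (single i).compLp ((proj i).compLp g) := by
    refine Lp.ext ((Lp.coeFn_finsetSum _ _).trans ?_).symm
    filter_upwards [ae_all_iff.2 fun i => (single i).coeFn_compLp ((proj i).compLp g),
      ae_all_iff.2 fun i => (proj i).coeFn_compLp g] with x hsingle hproj
    ext j
    simp [hsingle, hproj, single, proj, Finset.sum_apply, Pi.single_apply]
  calc Λ g = ∑ i, Λ ((single i).compLp ((proj i).compLp g)) := by rw [← map_sum, ← hsum]
    _ = ∑ i, ∫ x, (proj i).compLp g x * ψ i x ∂μ := Finset.sum_congr rfl fun i _ => hψ i _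
    _ = ∫ x, ∑ i, (proj i).compLp g x * ψ i x ∂μ := (integral_finsetSum _ fun i _ =>
      (Lp.memLp _).integrable_mul (p := 1) (q := ∞) (Lp.memLp (ψ i))).symm
    _ = ∫ x, g x ⬝ᵥ hmem.toLp _ x ∂μ := by
      refine integral_congr_ae ?_
      filter_upwards [hmem.coeFn_toLp, ae_all_iff.2 fun i => (proj i).coeFn_compLp g]
        with x hx hproj
      simp only [hx, hproj, dotProduct, proj, ContinuousLinearMap.proj_apply]

end Dual

/-- The dot product on `ι → ℝ` as a continuous bilinear map, which gives access to the pairing of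
`L¹` and `L^∞` and to the integrability lemmas for bilinear maps. -/
noncomputable def dotProductL (ι : Type*) [Fintype ι] : (ι → ℝ) →L[ℝ] (ι → ℝ) →L[ℝ] ℝ :=
  LinearMap.toContinuousBilinearMap (dotProductBilin ℝ ℝ)

theorem exists_weakStarTendsto_subseq {n : ℕ} {r R : ℝ} {φ : ℕ → LInf n r} (hφ : ∀ k, ‖φ k‖ ≤ R) :
    ∃ (φ₀ : LInf n r) (σ : ℕ → ℕ), StrictMono σ ∧ WeakStarTendsto (fun k => φ (σ k)) φ₀ := by
  let Λ (ψ : LInf n r) := ((dotProductL (Fin n)).lpPairing (histMeasure r) 1 ∞).flip ψ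
  have hΛ_apply (ψ : LInf n r) (g) : Λ ψ g = ∫ s, g s ⬝ᵥ ψ s ∂(histMeasure r) :=
    (dotProductL (Fin n)).lpPairing_eq_integral g ψ
  have : Fact ((1 : ℝ≥0∞) ≠ ∞) := ⟨ENNReal.one_ne_top⟩
  obtain ⟨Λ₀, σ, hσ, hlim⟩ := exists_subseq_tendsto_strongDual (Λ := fun k => Λ (φ k))
    fun k => (ContinuousLinearMap.le_opNorm_of_le _ (hφ k))
  obtain ⟨φ₀, hφ₀⟩ := exists_strongDual_L1_eq_integral_dotProduct Λ₀
  refine ⟨φ₀, σ, hσ, fun g hg => ?_⟩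
  have htoL1 (ψ : LInf n r) : ∫ s, hg.toL1 g s ⬝ᵥ ψ s ∂(histMeasure r) =
      ∫ s, g s ⬝ᵥ ψ s ∂(histMeasure r) := by
    refine integral_congr_ae ?_
    filter_upwards [hg.coeFn_toL1] with s hs
    rw [hs]
  simpa only [hΛ_apply, hφ₀, htoL1] using hlim (hg.toL1 g)

section Segment

variable {n ℓ : ℕ} {r t₀ T t C : ℝ} {τ : Fin (ℓ + 1) → ℝ} {X Y : ℝ → Fin n → ℝ}

theorem LInf.norm_le_of_ae_norm_le {φ : LInf n r} (hC : 0 ≤ C)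
    (h : ∀ᵐ u ∂(histMeasure r), ‖φ u‖ ≤ C) : ‖φ‖ ≤ C := by
  simpa using Lp.norm_le_of_ae_bound hC h

theorem ae_sub_of_ae_histMeasure {P : ℝ → Prop} (h : ∀ᵐ u ∂(histMeasure r), P u) (c : ℝ) :
    ∀ᵐ s, s - c ∈ Icc (-r) 0 → P (s - c) :=
  (measurePreserving_sub_right volume c).quasiMeasurePreserving.ae
    ((ae_restrict_iff' measurableSet_Icc).1 h)

theorem coeFn_segment (hX : MemLp (fun s => X (t + s)) ∞ (histMeasure r)) :
    segment r X t =ᵐ[histMeasure r] fun s => X (t + s) := by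
  rw [segment, dif_pos hX]
  exact hX.coeFn_toLp

theorem segment_congr (h : ∀ u ∈ Icc (t - r) t, X u = Y u) : segment r X t = segment r Y t := by
  have hae : (fun s => X (t + s)) =ᵐ[histMeasure r] fun s => Y (t + s) :=
    ae_restrict_of_forall_mem measurableSet_Icc fun s hs =>
      h (t + s) ⟨by linarith [hs.1], by linarith [hs.2]⟩
  unfold segment
  split_ifs with hX hY hY
  · exact MemLp.toLp_congr _ _ hae
  · exact absurd ((memLp_congr_ae hae).1 hX) hY
  · exact absurd ((memLp_congr_ae hae).2 hY) hX
  · rfl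

theorem norm_segment_le (hC : 0 ≤ C) (h : ∀ᵐ u, u ∈ Icc (t - r) t → ‖X u‖ ≤ C) :
    ‖segment r X t‖ ≤ C := by
  by_cases hX : MemLp (fun s => X (t + s)) ∞ (histMeasure r)
  · refine LInf.norm_le_of_ae_norm_le hC ?_
    filter_upwards [coeFn_segment hX, ae_restrict_mem measurableSet_Icc, ae_restrict_of_ae
      ((measurePreserving_add_left volume t).quasiMeasurePreserving.ae h)] with s hs hmem hXs
    rw [hs]
    exact hXs ⟨by linarith [hmem.1], by linarith [hmem.2]⟩
  · rwa [segment, dif_neg hX, norm_zero]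

theorem norm_segment_sub_segment_le (hX : MemLp (fun s => X (t + s)) ∞ (histMeasure r))
    (hY : MemLp (fun s => Y (t + s)) ∞ (histMeasure r)) (hC : 0 ≤ C)
    (h : ∀ u ≤ t, ‖X u - Y u‖ ≤ C) : ‖segment r X t - segment r Y t‖ ≤ C := by
  refine LInf.norm_le_of_ae_norm_le hC ?_
  filter_upwards [Lp.coeFn_sub (segment r X t) (segment r Y t), coeFn_segment hX, coeFn_segment hY,
    ae_restrict_mem measurableSet_Icc] with s hsub hXs hYs hs
  rw [hsub, Pi.sub_apply, hXs, hYs]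
  exact h (t + s) (by linarith [hs.2])

theorem ae_norm_delayed_le (hτ : ∀ i, τ i ∈ Icc 0 r) (hC : 0 ≤ C)
    (h : ∀ᵐ u, u ∈ Icc (t₀ - r) T → ‖X u‖ ≤ C) :
    ∀ᵐ s, s ∈ Icc t₀ T → ‖delayed τ X s‖ ≤ C := by
  have hi : ∀ᵐ s, ∀ i, s - τ i ∈ Icc (t₀ - r) T → ‖X (s - τ i)‖ ≤ C := ae_all_iff.2 fun i =>
    (measurePreserving_sub_right volume (τ i)).quasiMeasurePreserving.ae h
  filter_upwards [hi] with s hs hsT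
  exact (pi_norm_le_iff_of_nonneg hC).2 fun i =>
    hs i ⟨by linarith [hsT.1, (hτ i).2], by linarith [hsT.2, (hτ i).1]⟩

theorem norm_delayed_sub_delayed_le (hτ : ∀ i, 0 ≤ τ i) (hC : 0 ≤ C)
    (h : ∀ u ≤ t, ‖X u - Y u‖ ≤ C) : ‖delayed τ X t - delayed τ Y t‖ ≤ C :=
  (pi_norm_le_iff_of_nonneg hC).2 fun i => h _ (by linarith [hτ i])

end Segment

section Conc

variable {n ℓ : ℕ} {r t₀ T t R : ℝ} {τ : Fin (ℓ + 1) → ℝ} {x y : ℝ → Fin n → ℝ} {φ : LInf n r}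

theorem conc_of_le {ψ : ℝ → Fin n → ℝ} (ht : t₀ ≤ t) : conc t₀ ψ x t = x t :=
  if_neg ht.not_gt

theorem norm_conc_sub_conc_le {ψ : ℝ → Fin n → ℝ} (hR : 0 ≤ R)
    (h : ∀ u ∈ Icc t₀ t, ‖x u - y u‖ ≤ R) : ∀ u ≤ t, ‖conc t₀ ψ x u - conc t₀ ψ y u‖ ≤ R := by
  intro u hu
  unfold conc
  split_ifs with hu₀
  · rwa [sub_self, norm_zero]
  · exact h u ⟨not_lt.1 hu₀, hu⟩

theorem ae_norm_conc_le (hφ : ‖φ‖ ≤ R) (hx : ∀ t ∈ Ico t₀ T, ‖x t‖ ≤ R) :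
    ∀ᵐ s, s ∈ Icc (t₀ - r) T → ‖conc t₀ φ x s‖ ≤ R := by
  have hφ' : ∀ᵐ u ∂(histMeasure r), ‖φ u‖ ≤ R := by
    filter_upwards [ae_le_lpNorm_exponent_top (Lp.memLp φ)] with u hu
    rw [← toReal_eLpNorm (Lp.memLp φ).1, ← Lp.norm_def] at hu
    exact hu.trans hφ
  filter_upwards [ae_sub_of_ae_histMeasure hφ' t₀, Measure.ae_ne volume T] with s hs hne hsT
  unfold conc
  split_ifs with hs₀
  · exact hs ⟨by linarith [hsT.1], by linarith⟩
  · exact hx s ⟨not_lt.1 hs₀, lt_of_le_of_ne hsT.2 hne⟩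

theorem ae_norm_delayed_conc_le (hτ : ∀ i, τ i ∈ Icc 0 r) (hφ : ‖φ‖ ≤ R)
    (hx : ∀ t ∈ Ico t₀ T, ‖x t‖ ≤ R) :
    ∀ᵐ s, s ∈ Icc t₀ T → ‖delayed τ (conc t₀ φ x) s‖ ≤ R :=
  ae_norm_delayed_le hτ ((norm_nonneg _).trans hφ) (ae_norm_conc_le hφ hx)

theorem norm_segment_conc_le (hφ : ‖φ‖ ≤ R) (hx : ∀ t ∈ Ico t₀ T, ‖x t‖ ≤ R)
    (ht : t ∈ Icc t₀ T) : ‖segment r (conc t₀ φ x) t‖ ≤ R := by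
  refine norm_segment_le ((norm_nonneg _).trans hφ) ?_
  filter_upwards [ae_norm_conc_le hφ hx] with u hu hut
  exact hu ⟨by linarith [ht.1, hut.1], hut.2.trans ht.2⟩

end Conc

section WeakStar

variable {n : ℕ} {r t₀ T t : ℝ} {x g : ℝ → Fin n → ℝ}

/-- The adjoint of the map that sends a history to the part of it still visible in the segment at
elapsed time `c`. It turns a test function for that segment into one for the history. -/
noncomputable def historyAdjoint (r c : ℝ) (g : ℝ → Fin n → ℝ) (u : ℝ) : Fin n → ℝ :=
  (Ico (-r) (-c)).indicator g (u - c)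

theorem integrable_historyAdjoint {c : ℝ} (hc : 0 ≤ c) (hg : Integrable g (histMeasure r)) :
    Integrable (historyAdjoint r c g) (histMeasure r) := by
  have hsub : Ico (-r) (-c) ⊆ Icc (-r) 0 := fun s hs => ⟨hs.1, by linarith [hs.2]⟩
  have hind : Integrable ((Ico (-r) (-c)).indicator g) volume :=
    (integrable_indicator_iff measurableSet_Ico).2 (IntegrableOn.mono_set hg hsub)
  exact (hind.comp_sub_right c).restrict

theorem setIntegral_dotProduct_conc_eq_historyAdjoint (ht : t₀ ≤ t) (ψ : ℝ → Fin n → ℝ) :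
    ∫ s in Iio (t₀ - t), g s ⬝ᵥ conc t₀ ψ x (t + s) ∂(histMeasure r) =
      ∫ u, historyAdjoint r (t - t₀) g u ⬝ᵥ ψ u ∂(histMeasure r) := by
  set c := t - t₀
  have hinter : Iio (t₀ - t) ∩ Icc (-r) 0 = Ico (-r) (-c) := by
    ext s
    simp only [mem_inter_iff, mem_Iio, mem_Icc, mem_Ico]
    grind
  calc ∫ s in Iio (t₀ - t), g s ⬝ᵥ conc t₀ ψ x (t + s) ∂(histMeasure r)
      = ∫ s in Ico (-r) (-c), g s ⬝ᵥ conc t₀ ψ x (t + s) := by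
        rw [Measure.restrict_restrict measurableSet_Iio, hinter]
    _ = ∫ s in Ico (-r) (-c), g s ⬝ᵥ ψ (s + c) :=
        setIntegral_congr_fun measurableSet_Ico fun s hs => by
          have hst : t + s < t₀ := by linarith [hs.2]
          simp only [conc, if_pos hst]
          congr 2
          ring
    _ = ∫ s, (Ico (-r) (-c)).indicator g s ⬝ᵥ ψ (s + c) := by
        rw [← integral_indicator measurableSet_Ico]
        congr 1 with s
        by_cases hs : s ∈ Ico (-r) (-c) <;> simp [hs]
    _ = ∫ u, historyAdjoint r c g u ⬝ᵥ ψ u := by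
        rw [← integral_sub_right_eq_self _ c]
        simp only [historyAdjoint, sub_add_cancel]
    _ = ∫ u, historyAdjoint r c g u ⬝ᵥ ψ u ∂(histMeasure r) := by
        refine (setIntegral_eq_integral_of_forall_compl_eq_zero fun u hu => ?_).symm
        have hu' : u - c ∉ Ico (-r) (-c) := fun h => hu ⟨by linarith [h.1], by linarith [h.2]⟩
        rw [historyAdjoint, indicator_of_notMem hu', zero_dotProduct]

theorem integral_dotProduct_segment_conc (hx : ContinuousOn x (Icc t₀ T)) (ht : t ∈ Icc t₀ T)
    (hg : Integrable g (histMeasure r)) (ψ : LInf n r) :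
    ∫ s, g s ⬝ᵥ segment r (conc t₀ ψ x) t s ∂(histMeasure r) =
      ∫ u, historyAdjoint r (t - t₀) g u ⬝ᵥ ψ u ∂(histMeasure r) +
        ∫ s in (Iio (t₀ - t))ᶜ, g s ⬝ᵥ x (t + s) ∂(histMeasure r) := by
  have hmem := memLp_conc_segment (Lp.memLp ψ) hx ht
  have hint : Integrable (fun s => g s ⬝ᵥ conc t₀ ψ x (t + s)) (histMeasure r) :=
    memLp_one_iff_integrable.1
      ((dotProductL (Fin n)).memLp_of_bilin 1 (memLp_one_iff_integrable.2 hg) hmem)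
  calc ∫ s, g s ⬝ᵥ segment r (conc t₀ ψ x) t s ∂(histMeasure r)
      = ∫ s, g s ⬝ᵥ conc t₀ ψ x (t + s) ∂(histMeasure r) := by
        refine integral_congr_ae ?_
        filter_upwards [coeFn_segment hmem] with s hs
        rw [hs]
    _ = ∫ s in Iio (t₀ - t), g s ⬝ᵥ conc t₀ ψ x (t + s) ∂(histMeasure r) +
          ∫ s in (Iio (t₀ - t))ᶜ, g s ⬝ᵥ conc t₀ ψ x (t + s) ∂(histMeasure r) :=
        (integral_add_compl measurableSet_Iio hint).symm
    _ = _ := by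
        rw [setIntegral_dotProduct_conc_eq_historyAdjoint ht.1]
        congr 1
        refine setIntegral_congr_fun measurableSet_Iio.compl fun s hs => ?_
        have hs' : t₀ - t ≤ s := not_lt.1 hs
        simp only [conc_of_le (show t₀ ≤ t + s by linarith)]

theorem WeakStarTendsto.segment_conc {φ : ℕ → LInf n r} {φ₀ : LInf n r} (h : WeakStarTendsto φ φ₀)
    (hx : ContinuousOn x (Icc t₀ T)) (ht : t ∈ Icc t₀ T) :
    WeakStarTendsto (fun k => segment r (conc t₀ (φ k) x) t) (segment r (conc t₀ φ₀ x) t) := by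
  intro g hg
  simp only [integral_dotProduct_segment_conc hx ht hg]
  exact (h _ (integrable_historyAdjoint (sub_nonneg.2 ht.1) hg)).add_const _

end WeakStar

section Gronwall

variable {E : Type*} [SeminormedAddCommGroup E] {u : ℝ → E} {t₀ T L δ ρ : ℝ}

theorem norm_lt_of_forall_Ico_norm_le {b : ℝ → ℝ} (hu : ContinuousOn u (Icc t₀ T))
    (hb : ContinuousOn b (Icc t₀ T))
    (h : ∀ t ∈ Icc t₀ T, (∀ s ∈ Ico t₀ t, ‖u s‖ ≤ b s) → ‖u t‖ < b t) :
    ∀ t ∈ Icc t₀ T, ‖u t‖ < b t := by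
  by_contra! hcross
  obtain ⟨t, ht, hbt⟩ := hcross
  let S := {s ∈ Icc t₀ T | b s ≤ ‖u s‖}
  have hS_bdd : BddBelow S := ⟨t₀, fun s hs => hs.1.1⟩
  have hfirst : sInf S ∈ S :=
    (isClosed_Icc.isClosed_le hb hu.norm).csInf_mem ⟨t, ht, hbt⟩ hS_bdd
  refine hfirst.2.not_gt (h _ hfirst.1 fun s hs => ?_)
  by_contra! hbs
  exact hs.2.not_ge (csInf_le hS_bdd ⟨⟨hs.1, hs.2.le.trans hfirst.1.2⟩, hbs.le⟩)

theorem integral_mul_mul_exp (L δ t₀ t : ℝ) :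
    ∫ s in t₀..t, L * (δ * Real.exp (L * (s - t₀))) = δ * Real.exp (L * (t - t₀)) - δ := by
  have hderiv : ∀ s ∈ uIcc t₀ t, HasDerivAt (fun s => δ * Real.exp (L * (s - t₀)))
      (L * (δ * Real.exp (L * (s - t₀)))) s := fun s _ => by
    have hlin : HasDerivAt (fun s : ℝ => L * (s - t₀)) L s := by
      simpa using ((hasDerivAt_id s).sub_const t₀).const_mul L
    exact (hlin.exp.const_mul δ).congr_deriv (by ring)
  rw [intervalIntegral.integral_eq_sub_of_hasDerivAt hderiv
    (Continuous.intervalIntegrable (by fun_prop) _ _)]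
  simp

/-- For retarded equations: the past of `u` enters through a monotone majorant `m`, and the integral
inequality is only available while `m` stays below the threshold `ρ`. -/
theorem norm_le_mul_exp_of_local_integral_le (hu : ContinuousOn u (Icc t₀ T)) (hL : 0 ≤ L)
    (hδ : 0 ≤ δ) (hρ : δ * Real.exp (L * (T - t₀)) < ρ)
    (h : ∀ t ∈ Icc t₀ T, ∀ m : ℝ → ℝ, Continuous m → Monotone m → (∀ s ∈ Ico t₀ t, ‖u s‖ ≤ m s) →
      m t ≤ ρ → ‖u t‖ ≤ δ + ∫ s in t₀..t, L * m s) :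
    ∀ t ∈ Icc t₀ T, ‖u t‖ ≤ δ * Real.exp (L * (t - t₀)) := by
  have hstrict : ∀ δ' > δ, δ' * Real.exp (L * (T - t₀)) < ρ →
      ∀ t ∈ Icc t₀ T, ‖u t‖ < δ' * Real.exp (L * (t - t₀)) := by
    intro δ' hδ' hδ'ρ
    have hmono : Monotone fun s => δ' * Real.exp (L * (s - t₀)) := fun s t hst =>
      mul_le_mul_of_nonneg_left (Real.exp_le_exp.2 (by gcongr)) (hδ.trans hδ'.le)
    refine norm_lt_of_forall_Ico_norm_le hu (by fun_prop) fun t ht hlt => ?_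
    have hle := h t ht _ (by fun_prop) hmono hlt ((hmono ht.2).trans hδ'ρ.le)
    rw [integral_mul_mul_exp] at hle
    linarith
  intro t ht
  have htendsto (s : ℝ) : Tendsto (fun δ' => δ' * Real.exp (L * (s - t₀))) (𝓝[>] δ)
      (𝓝 (δ * Real.exp (L * (s - t₀)))) :=
    (continuous_mul_const _).continuousWithinAt
  refine ge_of_tendsto (htendsto t) ?_
  filter_upwards [self_mem_nhdsWithin, (htendsto T).eventually_lt_const hρ] with δ' hδ' hδ'ρ
  exact (hstrict δ' hδ' hδ'ρ t ht).le

end Gronwall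

/-- The right-hand side at time `s` along the concatenation of a history with `x`, where the
discrete delays see the history `φ` and the distributed delay sees the history `ψ`. A solution has
`φ = ψ`; the mixed case lets the two kinds of dependence on the history be treated one at a time. -/
noncomputable def along {n ℓ : ℕ} {r : ℝ} (τ : Fin (ℓ + 1) → ℝ) (f : RHS n ℓ r) (t₀ : ℝ)
    (φ ψ : LInf n r) (x : ℝ → Fin n → ℝ) (s : ℝ) : Fin n → ℝ :=
  f s (delayed τ (conc t₀ φ x) s) (segment r (conc t₀ ψ x) s)

/-- The local Lipschitz condition of the theory: `L` is a Lipschitz constant of `f t` on the ball of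
radius `R`, for almost every `t ∈ [0, T]`. -/
def IsEssLipschitz {n ℓ : ℕ} {r : ℝ} (f : RHS n ℓ r) (R T L : ℝ) : Prop :=
  ∀ᵐ t, t ∈ Icc 0 T → ∀ (ξ ζ : Fin (ℓ + 1) → Fin n → ℝ) (φ ψ : LInf n r),
    ‖ξ‖ ≤ R → ‖ζ‖ ≤ R → ‖φ‖ ≤ R → ‖ψ‖ ≤ R → ‖f t ξ φ - f t ζ ψ‖ ≤ L * max ‖ξ - ζ‖ ‖φ - ψ‖

section Along

variable {n ℓ : ℕ} {r t₀ T t R L : ℝ} {τ : Fin (ℓ + 1) → ℝ} {f : RHS n ℓ r} {φ : LInf n r}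
  {x y : ℝ → Fin n → ℝ}

theorem along_eq_of_add_le {s : ℝ} (hτ : ∀ i, τ i ≤ r) (f : RHS n ℓ r) (φ φ' ψ ψ' : LInf n r)
    (x : ℝ → Fin n → ℝ) (hs : t₀ + r ≤ s) : along τ f t₀ φ ψ x s = along τ f t₀ φ' ψ' x s := by
  have hdelayed : delayed τ (conc t₀ φ x) s = delayed τ (conc t₀ φ' x) s := by
    ext1 i
    have hi : t₀ ≤ s - τ i := by linarith [hτ i]
    simp only [delayed, conc_of_le hi]
  have hsegment : segment r (conc t₀ ψ x) s = segment r (conc t₀ ψ' x) s :=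
    segment_congr fun u hu => by
      have hu₀ : t₀ ≤ u := by linarith [hu.1]
      simp only [conc_of_le hu₀]
  rw [along, along, hdelayed, hsegment]

theorem UniformLipschitz.exists_isEssLipschitz (hf : UniformLipschitz τ {f}) (hR : 0 < R)
    (hT : 0 < T) : ∃ L, 0 ≤ L ∧ IsEssLipschitz f R T L := by
  obtain ⟨L, hL, hLip⟩ := hf.lipschitz R hR T hT
  obtain ⟨Z, hZ, hLipZ⟩ := hLip f rfl
  refine ⟨L, hL, ?_⟩
  filter_upwards [compl_mem_ae_iff.2 hZ] with t htZ htT using hLipZ t ⟨htT, htZ⟩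

theorem UniformLipschitz.exists_ae_norm_le (hf : UniformLipschitz τ {f}) (hR : 0 < R)
    (hT : 0 < T) : ∃ C, ∀ᵐ t, t ∈ Icc 0 T → ∀ (ξ : Fin (ℓ + 1) → Fin n → ℝ) (φ : LInf n r),
      ‖ξ‖ ≤ R → ‖φ‖ ≤ R → ‖f t ξ φ‖ ≤ C := by
  obtain ⟨L, hL, hLip⟩ := hf.exists_isEssLipschitz hR hT
  obtain ⟨M, hM⟩ := hf.bounded_zero T hT
  refine ⟨L * R + M, ?_⟩
  filter_upwards [hLip, (ae_restrict_iff' measurableSet_Icc).1 (hM f rfl)]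
    with t htL htM htT ξ φ hξ hφ
  have hsub := htL htT ξ 0 φ 0 hξ (by simpa using hR.le) hφ (by simpa using hR.le)
  rw [sub_zero, sub_zero] at hsub
  calc ‖f t ξ φ‖ ≤ ‖f t ξ φ - f t 0 0‖ + ‖f t 0 0‖ := norm_le_norm_sub_add _ _
    _ ≤ L * max ‖ξ‖ ‖φ‖ + M := add_le_add hsub (htM htT)
    _ ≤ L * R + M := by gcongr; exact max_le hξ hφ

theorem UniformLipschitz.exists_ae_norm_along_le (hf : UniformLipschitz τ {f})
    (hτ : ∀ i, τ i ∈ Icc 0 r) (ht₀ : 0 ≤ t₀) (hT : t₀ < T) (hR : 0 < R)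
    (hx : ∀ t ∈ Icc t₀ T, ‖x t‖ ≤ R) : ∃ C, ∀ φ ψ : LInf n r, ‖φ‖ ≤ R → ‖ψ‖ ≤ R →
      ∀ᵐ s, s ∈ Icc t₀ T → ‖along τ f t₀ φ ψ x s‖ ≤ C := by
  obtain ⟨C, hC⟩ := hf.exists_ae_norm_le hR (ht₀.trans_lt hT)
  have hx' : ∀ t ∈ Ico t₀ T, ‖x t‖ ≤ R := fun t ht => hx t (Ico_subset_Icc_self ht)
  refine ⟨C, fun φ ψ hφ hψ => ?_⟩
  filter_upwards [hC, ae_norm_delayed_conc_le hτ hφ hx'] with s hs hdelayed hsT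
  exact hs ⟨ht₀.trans hsT.1, hsT.2⟩ _ _ (hdelayed hsT) (norm_segment_conc_le hψ hx' hsT)

theorem UniformLipschitz.integrableOn_along (hf : UniformLipschitz τ {f}) (hτ : ∀ i, τ i ∈ Icc 0 r)
    (ht₀ : 0 ≤ t₀) (hT : t₀ < T) (φ : LInf n r) (hx : ContinuousOn x (Icc t₀ T)) :
    IntegrableOn (along τ f t₀ φ φ x) (Icc t₀ T) := by
  obtain ⟨C₀, hC₀⟩ := isCompact_Icc.exists_bound_of_continuousOn hx
  let R := max (max C₀ ‖φ‖) 1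
  obtain ⟨C, hC⟩ := hf.exists_ae_norm_along_le hτ ht₀ hT (R := R) (by positivity)
    fun t ht => (hC₀ t ht).trans ((le_max_left _ _).trans (le_max_left _ _))
  have hφR : ‖φ‖ ≤ R := (le_max_right _ _).trans (le_max_left _ _)
  exact Integrable.mono' (integrable_const C)
    (hf.measurable f rfl t₀ ht₀ T hT φ x (Lp.memLp φ) hx).aestronglyMeasurable
    ((ae_restrict_iff' measurableSet_Icc).2 (hC φ φ hφR hφR))

theorem UniformLipschitz.intervalIntegrable_along (hf : UniformLipschitz τ {f})
    (hτ : ∀ i, τ i ∈ Icc 0 r) (ht₀ : 0 ≤ t₀) (hT : t₀ < T) (φ : LInf n r)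
    (hx : ContinuousOn x (Icc t₀ T)) {a b : ℝ} (ha : a ∈ Icc t₀ T) (hb : b ∈ Icc t₀ T) :
    IntervalIntegrable (along τ f t₀ φ φ x) volume a b :=
  ((hf.integrableOn_along hτ ht₀ hT φ hx).mono_set
    (ordConnected_Icc.uIcc_subset ha hb)).intervalIntegrable

theorem IsEssLipschitz.ae_norm_along_sub_le (hLip : IsEssLipschitz f R T L)
    (hτ : ∀ i, τ i ∈ Icc 0 r) (hL : 0 ≤ L) (ht₀ : 0 ≤ t₀) (ht : t ∈ Icc t₀ T) (hφ : ‖φ‖ ≤ R)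
    (hx : ContinuousOn x (Icc t₀ T)) (hy : ContinuousOn y (Icc t₀ T))
    (hxR : ∀ s ∈ Ico t₀ t, ‖x s‖ ≤ R) (hyR : ∀ s ∈ Ico t₀ t, ‖y s‖ ≤ R) {m : ℝ → ℝ}
    (hm : Monotone m) (hxy : ∀ s ∈ Ico t₀ t, ‖x s - y s‖ ≤ m s) :
    ∀ᵐ s, s ∈ Ioc t₀ t → ‖along τ f t₀ φ φ x s - along τ f t₀ φ φ y s‖ ≤ L * m s := by
  filter_upwards [hLip, Measure.ae_ne volume t, ae_norm_delayed_conc_le hτ hφ hxR,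
    ae_norm_delayed_conc_le hτ hφ hyR] with s hs hne hdx hdy hst
  have hst' : s ∈ Icc t₀ t := Ioc_subset_Icc_self hst
  have hsT : s ∈ Icc t₀ T := ⟨hst'.1, hst'.2.trans ht.2⟩
  have hslt : s < t := lt_of_le_of_ne hst.2 hne
  have hm₀ : 0 ≤ m s := (norm_nonneg _).trans (hxy s ⟨hst'.1, hslt⟩)
  have hconc := norm_conc_sub_conc_le (ψ := φ) (t := s) hm₀ fun u hu =>
    (hxy u ⟨hu.1, hu.2.trans_lt hslt⟩).trans (hm hu.2)
  refine (hs ⟨ht₀.trans hsT.1, hsT.2⟩ _ _ _ _ (hdx hst') (hdy hst')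
    (norm_segment_conc_le hφ hxR hst') (norm_segment_conc_le hφ hyR hst')).trans ?_
  refine mul_le_mul_of_nonneg_left (max_le ?_ ?_) hL
  · exact norm_delayed_sub_delayed_le (fun i => (hτ i).1) hm₀ hconc
  · exact norm_segment_sub_segment_le (memLp_conc_segment (Lp.memLp φ) hx hsT)
      (memLp_conc_segment (Lp.memLp φ) hy hsT) hm₀ hconc

end Along

section Solution

variable {n ℓ : ℕ} {r t₀ T R L δ : ℝ} {τ : Fin (ℓ + 1) → ℝ} {f : RHS n ℓ r}
  {ξ ξ₀ : Fin n → ℝ} {φ φ₀ : LInf n r} {J J₀ : Set ℝ} {x x₀ : ℝ → Fin n → ℝ}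

theorem IsForwardInterval.subset_Ici (hJ : IsForwardInterval t₀ J) : J ⊆ Ici t₀ := by
  rcases hJ with rfl | ⟨b, -, rfl | rfl⟩
  exacts [subset_rfl, Ico_subset_Ici_self, Icc_subset_Ici_self]

theorem IsForwardInterval.Icc_subset (hJ : IsForwardInterval t₀ J) (hT : T ∈ J) :
    Icc t₀ T ⊆ J := by
  rcases hJ with rfl | ⟨b, -, rfl | rfl⟩
  exacts [Icc_subset_Ici_self, Icc_subset_Ico_right hT.2, Icc_subset_Icc_right hT.2]

theorem IsSolution.continuousOn (hx : IsSolution τ f t₀ ξ φ J x) (hT : T ∈ J) :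
    ContinuousOn x (Icc t₀ T) := by
  simpa only [uIcc_of_le (mem_Ici.1 (hx.interval.subset_Ici hT))]
    using (hx.absCont T hT).continuousOn

theorem IsSolution.sub_eq (hx : IsSolution τ f t₀ ξ φ J x)
    (hx₀ : IsSolution τ f t₀ ξ₀ φ₀ J₀ x₀) {t : ℝ} (ht : t ∈ J) (ht₀ : t ∈ J₀)
    (hint : IntervalIntegrable (along τ f t₀ φ φ x₀) volume t₀ t) :
    x t - x₀ t = (ξ - ξ₀)
      + ((∫ s in t₀..t, along τ f t₀ φ φ x₀ s) - ∫ s in t₀..t, along τ f t₀ φ₀ φ₀ x₀ s)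
      + ∫ s in t₀..t, (along τ f t₀ φ φ x s - along τ f t₀ φ φ x₀ s) := by
  have hxt : x t = ξ + ∫ s in t₀..t, along τ f t₀ φ φ x s := hx.eq_integral t ht
  have hx₀t : x₀ t = ξ₀ + ∫ s in t₀..t, along τ f t₀ φ₀ φ₀ x₀ s := hx₀.eq_integral t ht₀
  have hintx : IntervalIntegrable (along τ f t₀ φ φ x) volume t₀ t := hx.integrable t ht
  rw [intervalIntegral.integral_sub hintx hint, hxt, hx₀t]
  abel

/-- The smallness of `δ` keeps `x` within distance `1` of `x₀`, hence in the ball of radius `R` on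
which the Lipschitz constant `L` is valid. -/
theorem IsSolution.norm_sub_le (hx : IsSolution τ f t₀ ξ φ J x)
    (hx₀ : IsSolution τ f t₀ ξ₀ φ₀ J₀ x₀) (hf : UniformLipschitz τ {f})
    (hτ : ∀ i, τ i ∈ Icc 0 r) (ht₀ : 0 ≤ t₀) (hT : t₀ < T) (hTJ : T ∈ J) (hTJ₀ : T ∈ J₀)
    (hL : 0 ≤ L) (hLip : IsEssLipschitz f R T L) (hφ : ‖φ‖ ≤ R)
    (hx₀R : ∀ t ∈ Icc t₀ T, ‖x₀ t‖ + 1 ≤ R) (hδ : δ * Real.exp (L * (T - t₀)) < 1)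
    (hle : ∀ t ∈ Icc t₀ T, ‖ξ - ξ₀‖ + ‖(∫ s in t₀..t, along τ f t₀ φ φ x₀ s)
      - ∫ s in t₀..t, along τ f t₀ φ₀ φ₀ x₀ s‖ ≤ δ) :
    ∀ t ∈ Icc t₀ T, ‖x t - x₀ t‖ ≤ δ * Real.exp (L * (t - t₀)) := by
  have hxc := hx.continuousOn hTJ
  have hx₀c := hx₀.continuousOn hTJ₀
  have hδ₀ : 0 ≤ δ := (by positivity : (0 : ℝ) ≤ _).trans (hle t₀ ⟨le_rfl, hT.le⟩)
  refine norm_le_mul_exp_of_local_integral_le (hxc.sub hx₀c) hL hδ₀ hδ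
    fun t ht m hmc hmm hm hmt => ?_
  have hclose : ∀ s ∈ Ico t₀ t, ‖x s - x₀ s‖ ≤ m s := hm
  have hx₀R' : ∀ s ∈ Ico t₀ t, ‖x₀ s‖ + 1 ≤ R := fun s hs => hx₀R s ⟨hs.1, hs.2.le.trans ht.2⟩
  have hxR : ∀ s ∈ Ico t₀ t, ‖x s‖ ≤ R := fun s hs =>
    calc ‖x s‖ ≤ ‖x s - x₀ s‖ + ‖x₀ s‖ := norm_le_norm_sub_add _ _
      _ ≤ 1 + ‖x₀ s‖ := add_le_add_left ((hclose s hs).trans ((hmm hs.2.le).trans hmt)) _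
      _ ≤ R := add_comm (1 : ℝ) _ ▸ hx₀R' s hs
  have hLip' := hLip.ae_norm_along_sub_le hτ hL ht₀ ht hφ hxc hx₀c hxR
    (fun s hs => (lt_add_one _).le.trans (hx₀R' s hs)) hmm hclose
  have hint := hf.intervalIntegrable_along hτ ht₀ hT φ hx₀c ⟨le_rfl, hT.le⟩ ht
  rw [hx.sub_eq hx₀ (hx.interval.Icc_subset hTJ ht) (hx₀.interval.Icc_subset hTJ₀ ht) hint]
  exact (norm_add_le _ _).trans (add_le_add ((norm_add_le _ _).trans (hle t ht))
    (intervalIntegral.norm_integral_le_of_norm_le ht.1 hLip'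
      (Continuous.intervalIntegrable (by fun_prop) _ _)))

theorem IsSolution.eqOn {y : ℝ → Fin n → ℝ} (hx : IsSolution τ f t₀ ξ φ J x)
    (hy : IsSolution τ f t₀ ξ φ J₀ y) (hf : UniformLipschitz τ {f}) (hτ : ∀ i, τ i ∈ Icc 0 r)
    (ht₀ : 0 ≤ t₀) : EqOn x y (J ∩ J₀) := by
  rintro T ⟨hTJ, hTJ₀⟩
  rcases (mem_Ici.1 (hx.interval.subset_Ici hTJ)).eq_or_lt with rfl | hT
  · simp only [hx.eq_integral _ hTJ, hy.eq_integral _ hTJ₀, intervalIntegral.integral_same]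
  obtain ⟨C, hC⟩ := isCompact_Icc.exists_bound_of_continuousOn (hy.continuousOn hTJ₀)
  have hC₀ : 0 ≤ C := (norm_nonneg _).trans (hC T ⟨hT.le, le_rfl⟩)
  obtain ⟨L, hL, hLip⟩ := hf.exists_isEssLipschitz (R := max (C + 1) ‖φ‖) (T := T)
    (lt_max_of_lt_left (by positivity)) (ht₀.trans_lt hT)
  have hnorm := hx.norm_sub_le hy hf hτ ht₀ hT hTJ hTJ₀ hL hLip (le_max_right _ _)
    (fun t ht => le_max_of_le_left (add_le_add_left (hC t ht) 1)) (δ := 0) (by simp)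
    (fun t _ => by simp) T ⟨hT.le, le_rfl⟩
  rw [zero_mul] at hnorm
  exact sub_eq_zero.1 (norm_le_zero_iff.1 hnorm)

theorem IsMaximalSolution.eq_Ici {y : ℝ → Fin n → ℝ} (hx : IsMaximalSolution τ f t₀ ξ φ J x)
    (hy : IsSolution τ f t₀ ξ φ (Ici t₀) y) (hf : UniformLipschitz τ {f})
    (hτ : ∀ i, τ i ∈ Icc 0 r) (ht₀ : 0 ≤ t₀) : J = Ici t₀ := by
  have hJ := hx.1.interval.subset_Ici
  exact (hx.2 _ y hy hJ fun t ht => hx.1.eqOn hy hf hτ ht₀ ⟨ht, hJ ht⟩).symm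

end Solution

section WeakStar

variable {n ℓ : ℕ} {r t₀ T R : ℝ} {τ : Fin (ℓ + 1) → ℝ} {f : RHS n ℓ r} {φ : ℕ → LInf n r}
  {φ₀ : LInf n r} {x : ℝ → Fin n → ℝ}

theorem WeakStarAssumption.ae_tendsto_along_sub (hf : WeakStarAssumption τ {f})
    (hτ : ∀ i, τ i ∈ Icc 0 r) (ht₀ : 0 ≤ t₀) (hT : t₀ < T) (hR : 0 < R)
    (hx : ContinuousOn x (Icc t₀ T)) (hxR : ∀ t ∈ Icc t₀ T, ‖x t‖ ≤ R) (hφ : ∀ k, ‖φ k‖ ≤ R)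
    (h : WeakStarTendsto φ φ₀) : ∀ᵐ s, s ∈ Icc t₀ T →
      Tendsto (fun k => along τ f t₀ (φ k) (φ k) x s - along τ f t₀ (φ k) φ₀ x s) atTop (𝓝 0) := by
  obtain ⟨Z, hZ, hdist⟩ := hf.distributed T (ht₀.trans_lt hT) R hR
  have hxR' : ∀ t ∈ Ico t₀ T, ‖x t‖ ≤ R := fun t ht => hxR t (Ico_subset_Icc_self ht)
  filter_upwards [compl_mem_ae_iff.2 (hZ f rfl),
    ae_all_iff.2 fun k => ae_norm_delayed_conc_le hτ (hφ k) hxR'] with s hsZ hdelayed hs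
  rw [Metric.tendsto_atTop]
  intro ε hε
  obtain ⟨j, hj⟩ := hdist ε hε _ _ (fun k => norm_segment_conc_le (hφ k) hxR' hs)
    (h.segment_conc hx hs)
  refine ⟨j, fun k hk => ?_⟩
  rw [dist_zero_right]
  exact hj f rfl s ⟨⟨ht₀.trans hs.1, hs.2⟩, hsZ⟩ _ (hdelayed k hs) k hk

theorem WeakStarAssumption.eventually_intervalIntegrable_along (hf : WeakStarAssumption τ {f})
    (hτ : ∀ i, τ i ∈ Icc 0 r) (ht₀ : 0 ≤ t₀) (hT : t₀ < T) (hrT : t₀ + r ≤ T) (hR : 0 ≤ R)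
    (hx : ContinuousOn x (Icc t₀ T)) (hxR : ∀ t ∈ Icc t₀ T, ‖x t‖ ≤ R) (hφ : ∀ k, ‖φ k‖ ≤ R)
    (h : WeakStarTendsto φ φ₀) :
    ∀ᶠ k in atTop, IntervalIntegrable (along τ f t₀ (φ k) φ₀ x) volume t₀ (t₀ + r) := by
  have hr : t₀ ≤ t₀ + r := le_add_of_nonneg_right ((hτ 0).1.trans (hτ 0).2)
  have hsub : Icc t₀ (t₀ + r) ⊆ Icc t₀ T := Icc_subset_Icc_right hrT
  obtain ⟨j, hj⟩ := hf.discrete t₀ ht₀ R hR x (hx.mono hsub) (fun t ht => hxR t (hsub ht)) φ φ₀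
    hφ h 1 one_pos
  filter_upwards [eventually_ge_atTop j] with k hk
  have hint := hf.intervalIntegrable_along hτ ht₀ hT φ₀ hx ⟨le_rfl, hT.le⟩ ⟨hr, hrT⟩
  refine ((hj _ ⟨hr, le_rfl⟩ k hk f rfl).1.add hint).congr fun s _ => ?_
  simp only [along, sub_add_cancel]

theorem WeakStarAssumption.tendstoUniformlyOn_integral_along_sub_distributed
    (hf : WeakStarAssumption τ {f}) (hτ : ∀ i, τ i ∈ Icc 0 r) (ht₀ : 0 ≤ t₀) (hT : t₀ < T)
    (hrT : t₀ + r ≤ T) (hR : 0 < R) (hx : ContinuousOn x (Icc t₀ T))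
    (hxR : ∀ t ∈ Icc t₀ T, ‖x t‖ ≤ R) (hφ : ∀ k, ‖φ k‖ ≤ R) (hφ₀ : ‖φ₀‖ ≤ R)
    (h : WeakStarTendsto φ φ₀) :
    TendstoUniformlyOn
      (fun k t => ∫ s in t₀..t, (along τ f t₀ (φ k) (φ k) x s - along τ f t₀ (φ k) φ₀ x s))
      0 atTop (Icc t₀ (t₀ + r)) := by
  have hr : t₀ ≤ t₀ + r := le_add_of_nonneg_right ((hτ 0).1.trans (hτ 0).2)
  have hsub : uIoc t₀ (t₀ + r) ⊆ Icc t₀ T :=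
    uIoc_of_le hr ▸ Ioc_subset_Icc_self.trans (Icc_subset_Icc_right hrT)
  let d k s := along τ f t₀ (φ k) (φ k) x s - along τ f t₀ (φ k) φ₀ x s
  have hd_int : ∀ᶠ k in atTop, IntervalIntegrable (d k) volume t₀ (t₀ + r) :=
    (hf.eventually_intervalIntegrable_along hτ ht₀ hT hrT hR.le hx hxR hφ h).mono fun k hk =>
      (hf.intervalIntegrable_along hτ ht₀ hT (φ k) hx ⟨le_rfl, hT.le⟩ ⟨hr, hrT⟩).sub hk
  obtain ⟨C, hC⟩ := hf.exists_ae_norm_along_le hτ ht₀ hT hR hxR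
  have hL1 : Tendsto (fun k => ∫ s in t₀..(t₀ + r), ‖d k s‖) atTop
      (𝓝 (∫ _ in t₀..(t₀ + r), (0 : ℝ))) := by
    refine intervalIntegral.tendsto_integral_filter_of_dominated_convergence (fun _ => C + C)
      (hd_int.mono fun k hk => (intervalIntegrable_iff.1 hk.norm).1)
      (Eventually.of_forall fun k => ?_) intervalIntegrable_const ?_
    · filter_upwards [hC _ _ (hφ k) (hφ k), hC _ _ (hφ k) hφ₀] with s hs hs' hst
      rw [norm_norm]
      exact norm_sub_le_of_le (hs (hsub hst)) (hs' (hsub hst))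
    · filter_upwards [hf.ae_tendsto_along_sub hτ ht₀ hT hR hx hxR hφ h] with s hs hst
      simpa only [norm_zero] using (hs (hsub hst)).norm
  rw [intervalIntegral.integral_zero] at hL1
  rw [Metric.tendstoUniformlyOn_iff]
  intro ε hε
  filter_upwards [hL1.eventually_lt_const hε, hd_int] with k hk hk_int t ht
  rw [Pi.zero_apply, dist_zero_left]
  calc ‖∫ s in t₀..t, d k s‖ ≤ ∫ s in t₀..t, ‖d k s‖ :=
        intervalIntegral.norm_integral_le_integral_norm ht.1
    _ ≤ ∫ s in t₀..(t₀ + r), ‖d k s‖ := intervalIntegral.integral_mono_interval le_rfl ht.1 ht.2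
        (ae_of_all _ fun _ => norm_nonneg _) hk_int.norm
    _ < ε := hk

theorem WeakStarAssumption.tendstoUniformlyOn_integral_along_sub_discrete
    (hf : WeakStarAssumption τ {f}) (ht₀ : 0 ≤ t₀) (hR : 0 ≤ R)
    (hx : ContinuousOn x (Icc t₀ (t₀ + r))) (hxR : ∀ t ∈ Icc t₀ (t₀ + r), ‖x t‖ ≤ R)
    (hφ : ∀ k, ‖φ k‖ ≤ R) (h : WeakStarTendsto φ φ₀) :
    TendstoUniformlyOn
      (fun k t => ∫ s in t₀..t, (along τ f t₀ (φ k) φ₀ x s - along τ f t₀ φ₀ φ₀ x s))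
      0 atTop (Icc t₀ (t₀ + r)) := by
  rw [Metric.tendstoUniformlyOn_iff]
  intro ε hε
  obtain ⟨j, hj⟩ := hf.discrete t₀ ht₀ R hR x hx hxR φ φ₀ hφ h ε hε
  filter_upwards [eventually_ge_atTop j] with k hk t ht
  rw [Pi.zero_apply, dist_zero_left]
  exact (hj t ht k hk f rfl).2

theorem WeakStarAssumption.tendstoUniformlyOn_integral_along_sub (hf : WeakStarAssumption τ {f})
    (hτ : ∀ i, τ i ∈ Icc 0 r) (ht₀ : 0 ≤ t₀) (hT : t₀ < T) (hrT : t₀ + r ≤ T) (hR : 0 < R)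
    (hx : ContinuousOn x (Icc t₀ T)) (hxR : ∀ t ∈ Icc t₀ T, ‖x t‖ ≤ R) (hφ : ∀ k, ‖φ k‖ ≤ R)
    (hφ₀ : ‖φ₀‖ ≤ R) (h : WeakStarTendsto φ φ₀) :
    TendstoUniformlyOn
      (fun k t => ∫ s in t₀..t, (along τ f t₀ (φ k) (φ k) x s - along τ f t₀ φ₀ φ₀ x s))
      0 atTop (Icc t₀ (t₀ + r)) := by
  have hr : t₀ ≤ t₀ + r := le_add_of_nonneg_right ((hτ 0).1.trans (hτ 0).2)
  have hsub : Icc t₀ (t₀ + r) ⊆ Icc t₀ T := Icc_subset_Icc_right hrT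
  have hsum := (hf.tendstoUniformlyOn_integral_along_sub_distributed hτ ht₀ hT hrT hR hx hxR hφ hφ₀
    h).add (hf.tendstoUniformlyOn_integral_along_sub_discrete ht₀ hR.le (hx.mono hsub)
      (fun t ht => hxR t (hsub ht)) hφ h)
  rw [add_zero] at hsum
  refine hsum.congr ?_
  filter_upwards [hf.eventually_intervalIntegrable_along hτ ht₀ hT hrT hR.le hx hxR hφ h]
    with k hk t ht
  have hint ψ := hf.intervalIntegrable_along hτ ht₀ hT ψ hx ⟨le_rfl, hT.le⟩ (hsub ht)
  have hmixed : IntervalIntegrable (along τ f t₀ (φ k) φ₀ x) volume t₀ t :=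
    hk.mono_set (uIcc_subset_uIcc left_mem_uIcc (uIcc_of_le hr ▸ ht))
  simp only [Pi.add_apply]
  rw [← intervalIntegral.integral_add ((hint (φ k)).sub hmixed) (hmixed.sub (hint φ₀))]
  simp only [sub_add_sub_cancel]

theorem WeakStarAssumption.tendstoUniformlyOn_integral_along (hf : WeakStarAssumption τ {f})
    (hτ : ∀ i, τ i ∈ Icc 0 r) (ht₀ : 0 ≤ t₀) (hT : t₀ < T) (hrT : t₀ + r ≤ T) (hR : 0 < R)
    (hx : ContinuousOn x (Icc t₀ T)) (hxR : ∀ t ∈ Icc t₀ T, ‖x t‖ ≤ R) (hφ : ∀ k, ‖φ k‖ ≤ R)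
    (hφ₀ : ‖φ₀‖ ≤ R) (h : WeakStarTendsto φ φ₀) :
    TendstoUniformlyOn (fun k t => ∫ s in t₀..t, along τ f t₀ (φ k) (φ k) x s)
      (fun t => ∫ s in t₀..t, along τ f t₀ φ₀ φ₀ x s) atTop (Icc t₀ T) := by
  have hr : t₀ ≤ t₀ + r := le_add_of_nonneg_right ((hτ 0).1.trans (hτ 0).2)
  have hsub_eq : ∀ k, ∀ t ∈ Icc t₀ T,
      (∫ s in t₀..t, along τ f t₀ (φ k) (φ k) x s) - ∫ s in t₀..t, along τ f t₀ φ₀ φ₀ x s =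
        ∫ s in t₀..(min t (t₀ + r)),
          (along τ f t₀ (φ k) (φ k) x s - along τ f t₀ φ₀ φ₀ x s) := fun k t ht => by
    have hmin : min t (t₀ + r) ∈ Icc t₀ T := ⟨le_min ht.1 hr, (min_le_left _ _).trans ht.2⟩
    have hint ψ {a b} := hf.intervalIntegrable_along hτ ht₀ hT ψ hx (a := a) (b := b)
    have hlate : ∫ s in (min t (t₀ + r))..t,
        (along τ f t₀ (φ k) (φ k) x s - along τ f t₀ φ₀ φ₀ x s) = 0 := by
      refine intervalIntegral.integral_zero_ae (ae_of_all _ fun s hs => ?_)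
      rw [uIoc_of_le (min_le_left _ _)] at hs
      have hrs : t₀ + r ≤ s := (min_lt_iff.1 hs.1).elim (fun hts => (hts.not_ge hs.2).elim) le_of_lt
      rw [along_eq_of_add_le (fun i => (hτ i).2) f (φ k) φ₀ (φ k) φ₀ x hrs, sub_self]
    have ht₀T : t₀ ∈ Icc t₀ T := ⟨le_rfl, hT.le⟩
    rw [← intervalIntegral.integral_sub (hint _ ht₀T ht) (hint _ ht₀T ht),
      ← intervalIntegral.integral_add_adjacent_intervals
        ((hint _ ht₀T hmin).sub (hint _ ht₀T hmin)) ((hint _ hmin ht).sub (hint _ hmin ht)),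
      hlate, add_zero]
  have hearly := hf.tendstoUniformlyOn_integral_along_sub hτ ht₀ hT hrT hR hx hxR hφ hφ₀ h
  rw [Metric.tendstoUniformlyOn_iff] at hearly ⊢
  intro ε hε
  filter_upwards [hearly ε hε] with k hk t ht
  rw [dist_comm, dist_eq_norm, hsub_eq k t ht]
  simpa only [Pi.zero_apply, dist_zero_left] using
    hk (min t (t₀ + r)) ⟨le_min ht.1 hr, min_le_right _ _⟩

end WeakStar

section ContinuousDependence

variable {n ℓ : ℕ} {r t₀ T R : ℝ} {τ : Fin (ℓ + 1) → ℝ} {f : RHS n ℓ r}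

theorem IsSolution.tendstoUniformlyOn {ξ : ℕ → Fin n → ℝ} {ξ₀ : Fin n → ℝ} {φ : ℕ → LInf n r}
    {φ₀ : LInf n r} {J : ℕ → Set ℝ} {J₀ : Set ℝ} {x : ℕ → ℝ → Fin n → ℝ} {x₀ : ℝ → Fin n → ℝ}
    (hx : ∀ k, IsSolution τ f t₀ (ξ k) (φ k) (J k) (x k)) (hx₀ : IsSolution τ f t₀ ξ₀ φ₀ J₀ x₀)
    (hf : WeakStarAssumption τ {f}) (hτ : ∀ i, τ i ∈ Icc 0 r) (ht₀ : 0 ≤ t₀) (hT : t₀ < T)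
    (hrT : t₀ + r ≤ T) (hTJ : ∀ k, T ∈ J k) (hTJ₀ : T ∈ J₀) (hξ : Tendsto ξ atTop (𝓝 ξ₀))
    (hφR : ∀ k, ‖φ k‖ ≤ R) (hφ : WeakStarTendsto φ φ₀) :
    TendstoUniformlyOn x x₀ atTop (Icc t₀ T) := by
  have hx₀c := hx₀.continuousOn hTJ₀
  obtain ⟨C, hC⟩ := isCompact_Icc.exists_bound_of_continuousOn hx₀c
  let R' := max (C + 1) (max R ‖φ₀‖)
  have hx₀R' : ∀ t ∈ Icc t₀ T, ‖x₀ t‖ + 1 ≤ R' := fun t ht =>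
    le_max_of_le_left (add_le_add_left (hC t ht) 1)
  have hφR' : ∀ k, ‖φ k‖ ≤ R' := fun k => le_max_of_le_right (le_max_of_le_left (hφR k))
  have hφ₀R' : ‖φ₀‖ ≤ R' := le_max_of_le_right (le_max_right _ _)
  have hR' : 0 < R' :=
    (add_pos_of_nonneg_of_pos (norm_nonneg (x₀ t₀)) one_pos).trans_le (hx₀R' t₀ ⟨le_rfl, hT.le⟩)
  obtain ⟨L, hL, hLip⟩ := hf.exists_isEssLipschitz hR' (ht₀.trans_lt hT)
  have hint := hf.tendstoUniformlyOn_integral_along hτ ht₀ hT hrT hR' hx₀c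
    (fun t ht => (lt_add_one _).le.trans (hx₀R' t ht)) hφR' hφ₀R' hφ
  rw [Metric.tendstoUniformlyOn_iff] at hint ⊢
  intro ε hε
  obtain ⟨δ, hδ, hδε⟩ : ∃ δ > 0, δ * Real.exp (L * (T - t₀)) < min ε 1 := by
    simpa only [mul_comm] using exists_pos_mul_lt (lt_min hε one_pos) (Real.exp (L * (T - t₀)))
  filter_upwards [Metric.tendsto_nhds.1 hξ (δ / 2) (by positivity),
    hint (δ / 2) (by positivity)] with k hk_ξ hk_int t ht
  have hle : ∀ t ∈ Icc t₀ T, ‖ξ k - ξ₀‖ + ‖(∫ s in t₀..t, along τ f t₀ (φ k) (φ k) x₀ s)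
      - ∫ s in t₀..t, along τ f t₀ φ₀ φ₀ x₀ s‖ ≤ δ := fun t ht => by
    rw [← dist_eq_norm, ← dist_eq_norm']
    linarith [hk_int t ht]
  calc dist (x₀ t) (x k t) = ‖x k t - x₀ t‖ := dist_eq_norm' _ _
    _ ≤ δ * Real.exp (L * (t - t₀)) := (hx k).norm_sub_le hx₀ hf.toUniformLipschitz hτ ht₀ hT
        (hTJ k) hTJ₀ hL hLip (hφR' k) hx₀R' (hδε.trans_le (min_le_right _ _)) hle t ht
    _ ≤ δ * Real.exp (L * (T - t₀)) := by gcongr; exact ht.2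
    _ < ε := hδε.trans_le (min_le_left _ _)

theorem exists_subseq_tendsto_weakStarTendsto {ξ : ℕ → Fin n → ℝ} {φ : ℕ → LInf n r}
    (hξ : ∀ k, ‖ξ k‖ ≤ R) (hφ : ∀ k, ‖φ k‖ ≤ R) :
    ∃ (ξ₀ : Fin n → ℝ) (φ₀ : LInf n r) (σ : ℕ → ℕ), StrictMono σ ∧
      Tendsto (ξ ∘ σ) atTop (𝓝 ξ₀) ∧ WeakStarTendsto (φ ∘ σ) φ₀ := by
  obtain ⟨φ₀, σ, hσ, hφ₀⟩ := exists_weakStarTendsto_subseq hφ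
  obtain ⟨ξ₀, -, ρ, hρ, hξ₀⟩ := (isCompact_closedBall (0 : Fin n → ℝ) R).tendsto_subseq
    (x := ξ ∘ σ) fun k => mem_closedBall_zero_iff.2 (hξ (σ k))
  exact ⟨ξ₀, φ₀, σ ∘ ρ, hσ.comp hρ, hξ₀, fun g hg => (hφ₀ g hg).comp hρ.tendsto_atTop⟩

theorem ForwardComplete.exists_forall_norm_le (h : ForwardComplete τ f)
    (hf : WeakStarAssumption τ {f}) (hτ : ∀ i, τ i ∈ Icc 0 r) (ht₀ : 0 ≤ t₀) (T R : ℝ) :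
    ∃ M, ∀ (ξ : Fin n → ℝ) (φ : LInf n r) (x : ℝ → Fin n → ℝ), ‖ξ‖ ≤ R → ‖φ‖ ≤ R →
      IsSolution τ f t₀ ξ φ (Ici t₀) x → ∀ t ∈ Icc t₀ T, ‖x t‖ ≤ M := by
  by_contra! hunbounded
  choose ξ φ x hξ hφ hx t ht hlarge using fun k : ℕ => hunbounded k
  obtain ⟨ξ₀, φ₀, σ, hσ, hξ₀, hφ₀⟩ := exists_subseq_tendsto_weakStarTendsto hξ hφ
  obtain ⟨x₀, hx₀, -⟩ := h t₀ ht₀ ξ₀ φ₀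
  obtain ⟨T', hTT', ht₀T', hrT'⟩ : ∃ T', T ≤ T' ∧ t₀ < T' ∧ t₀ + r ≤ T' :=
    ⟨max T (max (t₀ + 1) (t₀ + r)), by simp⟩
  have hlim : TendstoUniformlyOn (x ∘ σ) x₀ atTop (Icc t₀ T') :=
    IsSolution.tendstoUniformlyOn (fun k => hx (σ k)) hx₀ hf hτ ht₀ ht₀T' hrT'
      (fun _ => ht₀T'.le) ht₀T'.le hξ₀ (fun k => hφ (σ k)) hφ₀
  obtain ⟨C, hC⟩ := isCompact_Icc.exists_bound_of_continuousOn (hx₀.continuousOn (T := T') ht₀T'.le)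
  obtain ⟨k, hclose, hk⟩ := ((Metric.tendstoUniformlyOn_iff.1 hlim 1 one_pos).and
    (hσ.tendsto_atTop.eventually (eventually_ge_atTop ⌈C + 1⌉₊))).exists
  have hmem : t (σ k) ∈ Icc t₀ T' := Icc_subset_Icc_right hTT' (ht (σ k))
  have hnorm : ‖x (σ k) (t (σ k))‖ ≤ C + 1 :=
    calc ‖x (σ k) (t (σ k))‖ ≤ ‖x₀ (t (σ k))‖ + dist (x₀ (t (σ k))) (x (σ k) (t (σ k))) := by
          rw [dist_eq_norm]; exact norm_le_norm_add_norm_sub (x₀ _) (x (σ k) _)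
      _ ≤ C + 1 := add_le_add (hC _ hmem) (hclose _ hmem).le
  exact (hlarge (σ k)).not_ge (hnorm.trans (Nat.ceil_le.1 hk))

end ContinuousDependence

end DelaySystem

theorem corollary1_general {n ℓ : ℕ} {r : ℝ} {τ : Fin (ℓ + 1) → ℝ} (hτ : ∀ i, τ i ∈ Icc 0 r)
    {f : DelaySystem.RHS n ℓ r} (hf : DelaySystem.WeakStarAssumption τ {f}) :
    DelaySystem.ForwardComplete τ f ↔ DelaySystem.BoundedReachabilitySets τ f := by
  refine ⟨fun h => ⟨h, fun t₀ ht₀ T _ R _ => ?_⟩, fun h => h.1⟩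
  obtain ⟨M, hM⟩ := h.exists_forall_norm_le hf hτ ht₀ T R
  refine ⟨M, fun ξ φ hξ hφ J x hx t ht => ?_⟩
  obtain ⟨y, hy⟩ := h t₀ ht₀ ξ φ
  obtain rfl := hx.eq_Ici hy.1 hf.toUniformLipschitz hτ ht₀
  exact ⟨ht.1, hM ξ φ x hξ hφ hx.1 t ht⟩

theorem corollary1 (n ℓ : ℕ) (r : ℝ) (τ : Fin (ℓ + 1) → ℝ) (hτ : StrictMono τ) (hτ0 : τ 0 = 0)
    (hτr : τ (Fin.last ℓ) = r) (f : DelaySystem.RHS n ℓ r)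
    (hf : DelaySystem.WeakStarAssumption τ {f}) :
    DelaySystem.ForwardComplete τ f ↔ DelaySystem.BoundedReachabilitySets τ f :=
  corollary1_general
    (fun i => ⟨hτ0 ▸ hτ.monotone (Fin.zero_le i), hτr ▸ hτ.monotone (Fin.le_last i)⟩) hf
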